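/- Consider a memoryless half-duplex network with $N$ relays: node $i\in[1:N+1]$ has input alphabet $\mathcal X_i$ and output alphabet $\mathcal Y_i$ (standard Borel spaces), where inputs of index $N+1$ belong to the source, outputs of index $N+1$ to the destination, and $k\in[1:N]$ are the relays. Relay $k$ also has a state $S_k\in\{0,1\}$ ($0$ = listening, $1$ = transmitting), and the channel is a transition probability $\mathbb P_{Y_{[1:N+1]}|X_{[1:N+1]},S_{[1:N]}}$ such that the outputs do not depend on $X_k$ when $S_k=0$, and $Y_k$ is independent of all other random variables when $S_k=1$. Assume independent noises, $\mathbb P_{Y_{[1:N+1]}|X_{[1:N+1]},S_{[1:N]}}=\prod_{i=1}^{N+1}\mathbb P_{Y_i|X_{[1:N+1]},S_{[1:N]}}$, and fix independent inputs, $\mathbb P_{X_{[1:N+1]}|S_{[1:N]}}=\prod_{i=1}^{N+1}\mathbb P_{X_i|S_{[1:N]}}$. For a schedule $\mathbb P_{S_{[1:N]}}$ (a probability mass function on $\{0,1\}^N$) and a cut $\mathcal A\subseteq[1:N]$ let $$I^{(\mathrm{fix})}_{\mathcal A}=I\big(X_{N+1},X_{\mathcal A^c};\,Y_{N+1},Y_{\mathcal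 A}\,\big|\,X_{\mathcal A},S_{[1:N]}\big),$$ and assume that all these mutual informations are finite. Let $\mathsf C'=\sup_{\mathbb P_{S_{[1:N]}}}\min_{\mathcal A\subseteq[1:N]}I^{(\mathrm{fix})}_{\mathcal A}$. Then simple schedules are optimal: there is a schedule $\mathbb P_{S_{[1:N]}}$ with at most $N+1$ non-zero entries (out of $2^N$) that attains $\mathsf C'$, that is, $\min_{\mathcal A}I^{(\mathrm{fix})}_{\mathcal A}=\mathsf C'$ for it; in particular the supremum is a maximum. Consequently, whenever the capacity $\mathsf C$ of the network (possibly under average input cost constraints, such as power constraints) satisfies $\mathsf C'-\mathsf G_1\le\mathsf C\le\mathsf C'+\mathsf G_2$ with constants $\mathsf G_1,\mathsf G_2\ge 0$, the value $\min_{\mathcal A}I^{(\mathrm{fix})}_{\mathcal A}$ of this single schedule with at most $N+1$ active states satisfies the same two bounds in place of $\mathsf C'$. -/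

import Mathlib

namespace HalfDuplex

open MeasureTheory ProbabilityTheory InformationTheory
open scoped ENNReal NNReal

/-! ### Conditional mutual information on general alphabets -/

/-- The conditional mutual information `I(U; V | Z)`, in nats, of three random variables on a
probability space: the Kullback-Leibler divergence between the joint law `P_{Z,U,V}` and
`P_Z ⊗ (P_{U|Z} × P_{V|Z})`, the law that makes `U` and `V` conditionally independent given `Z`. -/
noncomputable def condMutualInfo {Ω α β γ : Type*} [MeasurableSpace Ω]
    [MeasurableSpace α] [StandardBorelSpace α] [Nonempty α]
    [MeasurableSpace β] [StandardBorelSpace β] [Nonempty β] [MeasurableSpace γ]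
    (U : Ω → α) (V : Ω → β) (Z : Ω → γ) (μ : Measure Ω) [IsFiniteMeasure μ] : ℝ≥0∞ :=
  klDiv (μ.map (fun ω => (Z ω, (U ω, V ω))))
    ((μ.map Z) ⊗ₘ ((condDistrib U Z μ) ×ₖ (condDistrib V Z μ)))

/-! ### Half-duplex relay networks -/

/-- A joint state of the `N` relays: `s k = false` if relay `k` is listening and `s k = true` if
it is transmitting. -/
abbrev State (N : ℕ) : Type := Fin N → Bool

/-- A memoryless half-duplex network with `N` relays. Relay `k` is the node `k.castSucc`. The node
`Fin.last N` stands for the source in the input alphabets `X` and for the destination in the output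
alphabets `Y`. The channel is the transition probability from relay states and inputs to outputs.
A listening relay does not influence the outputs through its input; the output of a
transmitting relay is independent of everything else. -/
structure Network (N : ℕ) (X Y : Fin (N + 1) → Type*)
    [∀ i, MeasurableSpace (X i)] [∀ i, MeasurableSpace (Y i)] where
  /-- the law of the outputs given the relay states and the inputs -/
  channel : Kernel (State N × (∀ i, X i)) (∀ i, Y i)
  isMarkovKernel : IsMarkovKernel channel
  listening : ∀ (k : Fin N) (s : State N) (x x' : ∀ i, X i), s k = false →
    (∀ i, i ≠ k.castSucc → x i = x' i) → channel (s, x) = channel (s, x')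
  transmitting : ∀ k : Fin N, ∃ ν : Measure (Y k.castSucc),
    ∀ (s : State N) (x : ∀ i, X i), s k = true →
      (channel (s, x)).map (fun y => y k.castSucc) = ν ∧
      IndepFun (fun y : ∀ i, Y i => y k.castSucc)
        (fun (y : ∀ i, Y i) (j : {j // j ≠ k.castSucc}) => y j) (channel (s, x))

attribute [instance] Network.isMarkovKernel

section

variable {N : ℕ} {X Y : Fin (N + 1) → Type*}
  [∀ i, MeasurableSpace (X i)] [∀ i, MeasurableSpace (Y i)]

/-- Independent noises: given the relay states and all inputs, the outputs are independent, so that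
their joint conditional law is the product of its marginals. -/
def Network.IndependentNoises (W : Network N X Y) : Prop :=
  ∀ (s : State N) (x : ∀ i, X i),
    W.channel (s, x) = Measure.pi (fun i => (W.channel (s, x)).map (fun y => y i))

/-- Independent inputs: given the relay states, the inputs of the nodes are independent, so that
their joint conditional law is the product of its marginals. -/
def IndependentInputs (Q : Kernel (State N) (∀ i, X i)) : Prop :=
  ∀ s : State N, Q s = Measure.pi (fun i => (Q s).map (fun x => x i))

/-- The joint law of relay states, inputs and outputs, for the schedule `p` (the law of the relay
states) and the conditional input law `Q`. -/
noncomputable def jointLaw (W : Network N X Y) (Q : Kernel (State N) (∀ i, X i))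
    (p : PMF (State N)) : Measure ((State N × (∀ i, X i)) × (∀ i, Y i)) :=
  (p.toMeasure ⊗ₘ Q) ⊗ₘ W.channel

instance (W : Network N X Y) (Q : Kernel (State N) (∀ i, X i)) [IsMarkovKernel Q]
    (p : PMF (State N)) : IsProbabilityMeasure (jointLaw W Q p) := by
  unfold jointLaw
  infer_instance

/-- The relays of a set `A`, as nodes. -/
def relayNodes (A : Finset (Fin N)) : Finset (Fin (N + 1)) := A.map Fin.castSuccEmb

variable [∀ i, StandardBorelSpace (X i)] [∀ i, Nonempty (X i)]
  [∀ i, StandardBorelSpace (Y i)] [∀ i, Nonempty (Y i)]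

/-- The mutual information across the cut `A` with a fixed schedule,
`I(X_{N+1}, X_{Aᶜ}; Y_{N+1}, Y_A | X_A, S)`. -/
noncomputable def cutInfo (W : Network N X Y) (Q : Kernel (State N) (∀ i, X i)) [IsMarkovKernel Q]
    (p : PMF (State N)) (A : Finset (Fin N)) : ℝ≥0∞ :=
  condMutualInfo
    (fun ω : (State N × (∀ i, X i)) × (∀ i, Y i) => ((relayNodes A)ᶜ).restrict ω.1.2)
    (fun ω => (insert (Fin.last N) (relayNodes A)).restrict ω.2)
    (fun ω => ((relayNodes A).restrict ω.1.2, ω.1.1))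
    (jointLaw W Q p)

/-- The minimum over the cuts, for the schedule `p`. -/
noncomputable def minCutInfo (W : Network N X Y) (Q : Kernel (State N) (∀ i, X i))
    [IsMarkovKernel Q] (p : PMF (State N)) : ℝ≥0∞ :=
  ⨅ A : Finset (Fin N), cutInfo W Q p A

/-- `C'`: the supremum over the schedules of the minimum over the cuts. -/
noncomputable def fixedScheduleRate (W : Network N X Y) (Q : Kernel (State N) (∀ i, X i))
    [IsMarkovKernel Q] : ℝ≥0∞ :=
  ⨆ p : PMF (State N), minCutInfo W Q p

end

/-! ### Codes and capacity -/

section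

variable {N : ℕ} (X Y : Fin (N + 1) → Type*)
  [∀ i, MeasurableSpace (X i)] [∀ i, MeasurableSpace (Y i)]

/-- A code with `M` messages and block length `n`. In slot `t` the source sends a function of the
message, and relay `k` chooses its input and its state as a function of the outputs that it has
observed in the slots `0, …, t - 1`. The encoders are given for all `t`; only their
values at `t < n` are used. -/
structure Code (n M : ℕ) where
  source : Fin M → ℕ → X (Fin.last N)
  relay : ∀ (k : Fin N) (t : ℕ), (Fin t → Y k.castSucc) → X k.castSucc × Bool
  measurable_relay : ∀ k t, Measurable (relay k t)
  decode : (Fin n → Y (Fin.last N)) → Fin M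
  measurable_decode : Measurable decode

/-- Average input cost constraints (such as power constraints), one for each node. The cost
function `0` imposes no constraint. -/
structure InputConstraint where
  cost : ∀ i, X i → ℝ≥0∞
  measurable_cost : ∀ i, Measurable (cost i)
  budget : Fin (N + 1) → ℝ≥0∞

variable {X Y} {n M : ℕ}

/-- The relay states and the inputs in slot `t`, given the message and all earlier outputs. -/
def Code.step (c : Code X Y n M) (m : Fin M) (t : ℕ) (h : Fin t → ∀ i, Y i) :
    State N × (∀ i, X i) :=
  (fun k => (c.relay k t (fun j => h j k.castSucc)).2,
    Fin.lastCases (motive := X) (c.source m t)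
      (fun k => (c.relay k t (fun j => h j k.castSucc)).1))

theorem Code.measurable_step (c : Code X Y n M) (m : Fin M) (t : ℕ) :
    Measurable (c.step m t) := by
  have hr : ∀ k : Fin N, Measurable fun h : Fin t → ∀ i, Y i =>
      c.relay k t (fun j => h j k.castSucc) := fun k =>
    (c.measurable_relay k t).comp (by fun_prop)
  refine Measurable.prodMk (measurable_pi_iff.2 fun k => (hr k).snd) (measurable_pi_iff.2 ?_)
  intro i
  induction i using Fin.lastCases with
  | last => simp
  | cast k => simpa using (hr k).fst

/-- The law of the outputs in the first `t` slots, given the message: the outputs of a slot are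
drawn from the channel at the current states and inputs, independently of the past otherwise. -/
noncomputable def Code.outputLaw (c : Code X Y n M) (W : Network N X Y) (m : Fin M) :
    (t : ℕ) → Measure (Fin t → ∀ i, Y i)
  | 0 => Measure.dirac Fin.elim0
  | t + 1 => (c.outputLaw W m t ⊗ₘ (W.channel.comap (c.step m t) (c.measurable_step m t))).map
      (fun hy => Fin.snoc (α := fun _ => ∀ i, Y i) hy.1 hy.2)

/-- The probability of a decoding error for a uniformly distributed message. -/
noncomputable def Code.errorProb (c : Code X Y n M) (W : Network N X Y) : ℝ≥0∞ :=
  (∑ m : Fin M, c.outputLaw W m n {y | c.decode (fun t => y t (Fin.last N)) ≠ m}) / M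

/-- The code meets the input constraints: for each message and node, the expected cost of the `n`
inputs is at most `n` times the budget. -/
def Code.Admissible (c : Code X Y n M) (W : Network N X Y) (B : InputConstraint X) : Prop :=
  ∀ (m : Fin M) (i : Fin (N + 1)),
    ∑ t ∈ Finset.range n, ∫⁻ h, B.cost i ((c.step m t h).2 i) ∂(c.outputLaw W m t)
      ≤ n * B.budget i

/-- The rate `R`, in nats per channel use, is achievable: for every `ε > 0` and all large block
lengths `n` there is an admissible code with at least `exp (n R)` messages and error probability
at most `ε`. -/
def Achievable (W : Network N X Y) (B : InputConstraint X) (R : ℝ≥0) : Prop :=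
  ∀ ε : ℝ≥0∞, 0 < ε → ∃ n₀ : ℕ, ∀ n, n₀ ≤ n → ∃ (M : ℕ) (c : Code X Y n M),
    Real.exp (n * R) ≤ M ∧ c.Admissible W B ∧ c.errorProb W ≤ ε

/-- The capacity, in nats per channel use. -/
noncomputable def capacity (W : Network N X Y) (B : InputConstraint X) : ℝ≥0∞ :=
  ⨆ (R : ℝ≥0) (_ : Achievable W B R), (R : ℝ≥0∞)

end

end HalfDuplex

/-!
Given the state, the information across a cut is a submodular function of the cut: by the chain
rule, this comes down to the conditional independence of disjoint blocks of inputs and of disjoint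
blocks of outputs. Under a schedule, the information across a cut is the average of these functions
over the states. The problem is thus a matrix game whose rows (the states) are submodular functions
of the columns (the cuts). By a dimension count, an extreme optimal strategy of a matrix game uses
at most as many rows as it has worst columns. If the rows are strictly submodular, then the worst
columns form a chain, because the union or the intersection of two incomparable ones would be worse
than both, and a chain of subsets of `[1:N]` has at most `N + 1` members. Submodular rows become
strictly submodular after subtracting `ε * |A| ^ 2`, and the bound on the support passes to the
limit `ε → 0`.
-/

namespace HalfDuplex

open MeasureTheory ProbabilityTheory InformationTheory
open scoped ENNReal

/-! ### Conditional mutual information -/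

section KullbackLeibler

variable {α β γ δ : Type*} [MeasurableSpace α] [MeasurableSpace β] [MeasurableSpace γ]
  [MeasurableSpace δ]

theorem klDiv_map_eq_of_leftInverse (μ ν : Measure α) [IsFiniteMeasure μ] [IsFiniteMeasure ν]
    {g : α → β} {h : β → α} (hg : Measurable g) (hh : Measurable h)
    (hgh : Function.LeftInverse h g) : klDiv (μ.map g) (ν.map g) = klDiv μ ν := by
  refine le_antisymm (klDiv_map_le μ ν hg) ?_
  simpa [Measure.map_map hh hg, hgh.comp_eq_id] using klDiv_map_le (μ.map g) (ν.map g) hh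

theorem map_prodMap_compProd (ν : Measure γ) [SFinite ν] (κ : Kernel γ α) [IsSFiniteKernel κ]
    {g : γ → δ} {h : δ → γ} {f : α → β} (hg : Measurable g) (hh : Measurable h)
    (hf : Measurable f) (hgh : ∀ᵐ z ∂ν, h (g z) = z) :
    (ν ⊗ₘ κ).map (Prod.map g f) = (ν.map g) ⊗ₘ ((κ.map f).comap h hh) := by
  refine Measure.ext_of_lintegral _ fun φ hφ => ?_
  have hφgf : Measurable fun x => φ (Prod.map g f x) := hφ.comp (hg.prodMap hf)
  rw [lintegral_map hφ (hg.prodMap hf), Measure.lintegral_compProd hφgf,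
    Measure.lintegral_compProd hφ, lintegral_map hφ.lintegral_kernel_prod_right' hg]
  refine lintegral_congr_ae (hgh.mono fun z hz => ?_)
  simp only [Kernel.comap_apply, hz, Kernel.map_apply _ hf, Prod.map_apply]
  rw [lintegral_map (by fun_prop) hf]

theorem map_assoc_symm_compProd_prod (ν : Measure γ) [SFinite ν] (κ : Kernel γ α)
    [IsSFiniteKernel κ] (η : Kernel γ β) [IsSFiniteKernel η] :
    (ν ⊗ₘ (κ ×ₖ η)).map MeasurableEquiv.prodAssoc.symm = (ν ⊗ₘ κ) ⊗ₘ (η.prodMkRight α) := by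
  refine Measure.ext_of_lintegral _ fun φ hφ => ?_
  rw [lintegral_map hφ (by fun_prop), Measure.lintegral_compProd (by fun_prop),
    Measure.lintegral_compProd hφ, Measure.lintegral_compProd (by fun_prop)]
  refine lintegral_congr fun z => ?_
  rw [Kernel.lintegral_prod _ _ _ (by fun_prop)]
  rfl

end KullbackLeibler

section CondMutualInfo

variable {Ω α β γ δ : Type*} [MeasurableSpace Ω] [MeasurableSpace α] [MeasurableSpace β]
  [MeasurableSpace γ] [MeasurableSpace δ] {μ : Measure Ω} [IsFiniteMeasure μ]
  {U : Ω → α} {V : Ω → β} {W : Ω → δ} {Z : Ω → γ}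

section

variable [StandardBorelSpace α] [Nonempty α]

theorem klDiv_map_compProd_condDistrib_prod (hU : Measurable U) (hV : Measurable V)
    (hZ : Measurable Z) (κ : Kernel γ β) [IsMarkovKernel κ] :
    klDiv (μ.map fun ω => (Z ω, (U ω, V ω))) ((μ.map Z) ⊗ₘ (condDistrib U Z μ ×ₖ κ)) =
      klDiv (μ.map fun ω => ((Z ω, U ω), V ω))
        ((μ.map fun ω => (Z ω, U ω)) ⊗ₘ κ.prodMkRight α) := by
  rw [← klDiv_map_eq_of_leftInverse _ _ MeasurableEquiv.prodAssoc.symm.measurable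
      MeasurableEquiv.prodAssoc.measurable MeasurableEquiv.prodAssoc.right_inv,
    map_assoc_symm_compProd_prod, compProd_map_condDistrib hU.aemeasurable,
    Measure.map_map MeasurableEquiv.prodAssoc.symm.measurable (hZ.prodMk (hU.prodMk hV))]
  rfl

end

theorem klDiv_map_swap_compProd_prod (hU : Measurable U) (hV : Measurable V)
    (hZ : Measurable Z) (κ : Kernel γ α) (η : Kernel γ β) [IsFiniteKernel κ] [IsFiniteKernel η] :
    klDiv (μ.map fun ω => (Z ω, (V ω, U ω))) ((μ.map Z) ⊗ₘ (η ×ₖ κ)) =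
      klDiv (μ.map fun ω => (Z ω, (U ω, V ω))) ((μ.map Z) ⊗ₘ (κ ×ₖ η)) := by
  rw [← klDiv_map_eq_of_leftInverse (μ.map fun ω => (Z ω, (U ω, V ω))) _
      (measurable_id.prodMap measurable_swap) (measurable_id.prodMap measurable_swap)
      (fun _ => rfl),
    map_prodMap_compProd _ _ measurable_id measurable_id measurable_swap (ae_of_all _ fun _ => rfl),
    Measure.map_map (by fun_prop) (by fun_prop), Measure.map_id, Kernel.map_prod_swap,
    Kernel.comap_id]
  rfl

variable [StandardBorelSpace α] [Nonempty α] [StandardBorelSpace β] [Nonempty β]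
  [StandardBorelSpace δ] [Nonempty δ]

theorem condMutualInfo_comm (hU : Measurable U) (hV : Measurable V) (hZ : Measurable Z) :
    condMutualInfo U V Z μ = condMutualInfo V U Z μ :=
  (klDiv_map_swap_compProd_prod hU hV hZ _ _).symm

theorem condMutualInfo_eq_klDiv_prodMkRight (hU : Measurable U) (hV : Measurable V)
    (hZ : Measurable Z) :
    condMutualInfo U V Z μ = klDiv (μ.map fun ω => ((Z ω, U ω), V ω))
      ((μ.map fun ω => (Z ω, U ω)) ⊗ₘ (condDistrib V Z μ).prodMkRight α) :=
  klDiv_map_compProd_condDistrib_prod hU hV hZ _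

theorem klDiv_map_compProd_prodMkRight (hU : Measurable U) (hV : Measurable V)
    (hZ : Measurable Z) (κ : Kernel γ β) [IsMarkovKernel κ] :
    klDiv (μ.map fun ω => ((Z ω, U ω), V ω)) ((μ.map fun ω => (Z ω, U ω)) ⊗ₘ κ.prodMkRight α) =
      klDiv (μ.map fun ω => (Z ω, V ω)) ((μ.map Z) ⊗ₘ κ) + condMutualInfo U V Z μ := by
  rw [← klDiv_map_compProd_condDistrib_prod hU hV hZ, ← klDiv_map_swap_compProd_prod hU hV hZ,
    ← klDiv_map_eq_of_leftInverse _ _ MeasurableEquiv.prodAssoc.symm.measurable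
      MeasurableEquiv.prodAssoc.measurable MeasurableEquiv.prodAssoc.right_inv,
    map_assoc_symm_compProd_prod,
    Measure.map_map MeasurableEquiv.prodAssoc.symm.measurable (hZ.prodMk (hV.prodMk hU))]
  change klDiv (μ.map fun ω => ((Z ω, V ω), U ω)) _ = _
  rw [condMutualInfo_comm hU hV hZ, condMutualInfo_eq_klDiv_prodMkRight hV hU hZ,
    ← compProd_map_condDistrib (X := fun ω => (Z ω, V ω)) hU.aemeasurable, klDiv_compProd_eq_add]

theorem condMutualInfo_prodMk_right (hU : Measurable U) (hV : Measurable V) (hW : Measurable W)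
    (hZ : Measurable Z) :
    condMutualInfo U (fun ω => (V ω, W ω)) Z μ =
      condMutualInfo U V Z μ + condMutualInfo U W (fun ω => (Z ω, V ω)) μ := by
  have hassoc := klDiv_map_eq_of_leftInverse
    (μ.map fun ω => ((Z ω, (V ω, W ω)), U ω))
    ((μ.map fun ω => (Z ω, (V ω, W ω))) ⊗ₘ (condDistrib U Z μ).prodMkRight (β × δ))
    (MeasurableEquiv.prodAssoc.symm.measurable.prodMap measurable_id)
    (MeasurableEquiv.prodAssoc.measurable.prodMap measurable_id) (fun _ => rfl)
  rw [map_prodMap_compProd _ _ MeasurableEquiv.prodAssoc.symm.measurable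
      MeasurableEquiv.prodAssoc.measurable measurable_id (ae_of_all _ fun _ => rfl),
    Measure.map_map (by fun_prop) (by fun_prop), Measure.map_map (by fun_prop) (by fun_prop),
    Kernel.map_id] at hassoc
  rw [condMutualInfo_comm hU (hV.prodMk hW) hZ,
    condMutualInfo_eq_klDiv_prodMkRight (hV.prodMk hW) hU hZ, ← hassoc,
    condMutualInfo_comm hU hW (hZ.prodMk hV), condMutualInfo_comm hU hV hZ,
    condMutualInfo_eq_klDiv_prodMkRight hV hU hZ]
  exact klDiv_map_compProd_prodMkRight hW hU (hZ.prodMk hV) ((condDistrib U Z μ).prodMkRight β)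

end CondMutualInfo

section ChangeOfLaw

variable {Ω Ω' α β γ : Type*} [MeasurableSpace Ω] [MeasurableSpace Ω']
  [MeasurableSpace α] [StandardBorelSpace α] [Nonempty α]
  [MeasurableSpace β] [StandardBorelSpace β] [Nonempty β] [MeasurableSpace γ]
  {μ : Measure Ω} [IsFiniteMeasure μ] {U : Ω → α} {V : Ω → β} {Z : Ω → γ}

theorem condMutualInfo_eq_klDiv_of_ae_eq {κ : Kernel γ α} {η : Kernel γ β}
    [IsSFiniteKernel κ] [IsSFiniteKernel η]
    (hκ : condDistrib U Z μ =ᵐ[μ.map Z] κ) (hη : condDistrib V Z μ =ᵐ[μ.map Z] η) :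
    condMutualInfo U V Z μ =
      klDiv (μ.map fun ω => (Z ω, (U ω, V ω))) ((μ.map Z) ⊗ₘ (κ ×ₖ η)) := by
  have hprod : condDistrib U Z μ ×ₖ condDistrib V Z μ =ᵐ[μ.map Z] κ ×ₖ η := by
    filter_upwards [hκ, hη] with z hκz hηz
    rw [Kernel.prod_apply, Kernel.prod_apply, hκz, hηz]
  rw [condMutualInfo, Measure.compProd_congr hprod]

theorem condMutualInfo_map {ν : Measure Ω'} [IsFiniteMeasure ν] {g : Ω' → Ω} (hg : Measurable g)
    (hU : Measurable U) (hV : Measurable V) (hZ : Measurable Z) :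
    condMutualInfo U V Z (ν.map g) = condMutualInfo (U ∘ g) (V ∘ g) (Z ∘ g) ν := by
  have hmap : (ν.map g).map Z = ν.map (Z ∘ g) := Measure.map_map hZ hg
  rw [condMutualInfo_eq_klDiv_of_ae_eq (κ := condDistrib (U ∘ g) (Z ∘ g) ν)
      (η := condDistrib (V ∘ g) (Z ∘ g) ν), hmap,
    Measure.map_map (hZ.prodMk (hU.prodMk hV)) hg]
  · rfl
  · rw [hmap]
    exact condDistrib_map hZ.aemeasurable hU.aemeasurable hg.aemeasurable
  · rw [hmap]
    exact condDistrib_map hZ.aemeasurable hV.aemeasurable hg.aemeasurable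

theorem condMutualInfo_eq_zero_of_map_eq_compProd_prod (hU : Measurable U) (hV : Measurable V)
    (hZ : Measurable Z) {κ : Kernel γ α} {η : Kernel γ β} [IsMarkovKernel κ] [IsMarkovKernel η]
    (h : (μ.map fun ω => (Z ω, (U ω, V ω))) = (μ.map Z) ⊗ₘ (κ ×ₖ η)) :
    condMutualInfo U V Z μ = 0 := by
  have hκ : condDistrib U Z μ =ᵐ[μ.map Z] κ := by
    refine condDistrib_ae_eq_of_measure_eq_compProd _ hU.aemeasurable ?_
    have hfst := congrArg (Measure.map (Prod.map id Prod.fst)) h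
    rwa [map_prodMap_compProd _ _ measurable_id measurable_id measurable_fst
        (ae_of_all _ fun _ => rfl), Measure.map_map (by fun_prop) (by fun_prop), Measure.map_id,
      Kernel.comap_id, ← Kernel.fst_eq, Kernel.fst_prod] at hfst
  have hη : condDistrib V Z μ =ᵐ[μ.map Z] η := by
    refine condDistrib_ae_eq_of_measure_eq_compProd _ hV.aemeasurable ?_
    have hsnd := congrArg (Measure.map (Prod.map id Prod.snd)) h
    rwa [map_prodMap_compProd _ _ measurable_id measurable_id measurable_snd
        (ae_of_all _ fun _ => rfl), Measure.map_map (by fun_prop) (by fun_prop), Measure.map_id,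
      Kernel.comap_id, ← Kernel.snd_eq, Kernel.snd_prod] at hsnd
  rw [condMutualInfo_eq_klDiv_of_ae_eq hκ hη, h, klDiv_self]

end ChangeOfLaw

section Monotonicity

variable {Ω α α' β β' γ γ' : Type*} [MeasurableSpace Ω]
  [mα : MeasurableSpace α] [StandardBorelSpace α] [Nonempty α]
  [mα' : MeasurableSpace α'] [StandardBorelSpace α'] [Nonempty α']
  [mβ : MeasurableSpace β] [StandardBorelSpace β] [Nonempty β]
  [mβ' : MeasurableSpace β'] [StandardBorelSpace β'] [Nonempty β']
  [mγ : MeasurableSpace γ] [mγ' : MeasurableSpace γ']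
  {μ : Measure Ω} [IsFiniteMeasure μ]
  {U : Ω → α} {U' : Ω → α'} {V : Ω → β} {V' : Ω → β'} {Z : Ω → γ} {Z' : Ω → γ'}

theorem condDistrib_comp_comp (hU : Measurable U) (hZ : Measurable Z)
    {f : α → α'} {g : γ → γ'} {h : γ' → γ} (hf : Measurable f) (hg : Measurable g)
    (hh : Measurable h) (hgh : ∀ᵐ z ∂μ.map Z, h (g z) = z) :
    condDistrib (f ∘ U) (g ∘ Z) μ =ᵐ[μ.map (g ∘ Z)] ((condDistrib U Z μ).map f).comap h hh := by
  have := Kernel.IsMarkovKernel.map (condDistrib U Z μ) hf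
  refine condDistrib_ae_eq_of_measure_eq_compProd _ (hf.comp hU).aemeasurable ?_
  rw [← Measure.map_map hg hZ, ← map_prodMap_compProd _ _ hg hh hf hgh,
    compProd_map_condDistrib hU.aemeasurable, Measure.map_map (by fun_prop) (hZ.prodMk hU)]
  rfl

theorem condMutualInfo_comp_le (hU : Measurable U) (hV : Measurable V) (hZ : Measurable Z)
    {f : α → α'} {f' : β → β'} {g : γ → γ'} {h : γ' → γ} (hf : Measurable f) (hf' : Measurable f')
    (hg : Measurable g) (hh : Measurable h) (hgh : ∀ᵐ z ∂μ.map Z, h (g z) = z) :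
    condMutualInfo (f ∘ U) (f' ∘ V) (g ∘ Z) μ ≤ condMutualInfo U V Z μ := by
  have := Kernel.IsMarkovKernel.map (condDistrib U Z μ) hf
  have := Kernel.IsMarkovKernel.map (condDistrib V Z μ) hf'
  rw [condMutualInfo_eq_klDiv_of_ae_eq (condDistrib_comp_comp hU hZ hf hg hh hgh)
      (condDistrib_comp_comp hV hZ hf' hg hh hgh), ← Kernel.comap_prod,
    Kernel.map_prod_map _ _ hf hf', ← Measure.map_map hg hZ,
    ← map_prodMap_compProd _ _ hg hh (hf.prodMap hf') hgh]
  have hdata := klDiv_map_le (μ.map fun ω => (Z ω, (U ω, V ω)))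
    ((μ.map Z) ⊗ₘ (condDistrib U Z μ ×ₖ condDistrib V Z μ)) (hg.prodMap (hf.prodMap hf'))
  rwa [Measure.map_map (hg.prodMap (hf.prodMap hf')) (hZ.prodMk (hU.prodMk hV))] at hdata

variable [StandardBorelSpace γ] [Nonempty γ] [StandardBorelSpace γ'] [Nonempty γ']

theorem condMutualInfo_mono (hU : Measurable U) (hV : Measurable V) (hZ : Measurable Z)
    (hUU' : mα'.comap U' ≤ mα.comap U)
    (hVV' : mβ'.comap V' ≤ mβ.comap V)
    (hZZ' : mγ'.comap Z' = mγ.comap Z) :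
    condMutualInfo U' V' Z' μ ≤ condMutualInfo U V Z μ := by
  obtain ⟨f, hf, rfl⟩ := (Measurable.of_comap_le hUU').exists_eq_measurable_comp
  obtain ⟨f', hf', rfl⟩ := (Measurable.of_comap_le hVV').exists_eq_measurable_comp
  obtain ⟨g, hg, rfl⟩ := (Measurable.of_comap_le hZZ'.le).exists_eq_measurable_comp
  obtain ⟨h, hh, hZ_eq⟩ := (Measurable.of_comap_le hZZ'.ge).exists_eq_measurable_comp
  refine condMutualInfo_comp_le hU hV hZ hf hf' hg hh ?_
  exact (ae_map_iff hZ.aemeasurable (measurableSet_eq_fun (hh.comp hg) measurable_id)).2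
    (ae_of_all _ fun ω => (congrFun hZ_eq ω).symm)

theorem condMutualInfo_congr (hU : Measurable U) (hV : Measurable V) (hZ : Measurable Z)
    (hU' : Measurable U') (hV' : Measurable V') (hZ' : Measurable Z')
    (hUU' : mα'.comap U' = mα.comap U)
    (hVV' : mβ'.comap V' = mβ.comap V)
    (hZZ' : mγ'.comap Z' = mγ.comap Z) :
    condMutualInfo U' V' Z' μ = condMutualInfo U V Z μ :=
  le_antisymm (condMutualInfo_mono hU hV hZ hUU'.le hVV'.le hZZ')
    (condMutualInfo_mono hU' hV' hZ' hUU'.ge hVV'.ge hZZ'.symm)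

end Monotonicity

section Mixture

variable {S Ω α β γ δ : Type*} [MeasurableSpace S] [MeasurableSpace Ω] [MeasurableSpace α]
  [MeasurableSpace β] [MeasurableSpace γ] [MeasurableSpace δ]

theorem sectR_prod (η : Kernel (S × γ) α) [IsSFiniteKernel η] (ξ : Kernel (S × γ) β)
    [IsSFiniteKernel ξ] (s : S) : (η ×ₖ ξ).sectR s = η.sectR s ×ₖ ξ.sectR s := by
  ext z : 1
  simp only [Kernel.sectR_apply, Kernel.prod_apply]

theorem map_prodMk_fst_compProd (ρ : Measure S) [SFinite ρ] {κ : Kernel S Ω} [IsSFiniteKernel κ]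
    {Z : Ω → γ} (hZ : Measurable Z) (η : Kernel (S × γ) δ) :
    (ρ ⊗ₘ κ).map (fun ω => (ω.1, Z ω.2)) ⊗ₘ η =
      (ρ ⊗ₘ (κ.map Z ⊗ₖ η)).map MeasurableEquiv.prodAssoc.symm := by
  rw [Measure.compProd_assoc, Measure.compProd_map hZ]
  rfl

variable [DiscreteMeasurableSpace S]

theorem klDiv_compProd_right_eq_sum [Fintype S] (ρ : Measure S) [IsFiniteMeasure ρ]
    (κ η : Kernel S α) [IsMarkovKernel κ] [IsMarkovKernel η] :
    klDiv (ρ ⊗ₘ κ) (ρ ⊗ₘ η) = ∑ s, ρ {s} * klDiv (κ s) (η s) := by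
  by_cases hac : ∀ᵐ s ∂ρ, κ s ≪ η s
  · let φ : S × α → ℝ≥0∞ := fun v => (κ v.1).rnDeriv (η v.1) v.2
    have hφ : Measurable φ :=
      measurable_from_prod_countable_right fun s => Measure.measurable_rnDeriv (κ s) (η s)
    have hdensity : ρ ⊗ₘ κ = (ρ ⊗ₘ η).withDensity φ := by
      ext A hA
      rw [Measure.compProd_apply hA, withDensity_apply _ hA, ← lintegral_indicator hA,
        Measure.lintegral_compProd (hφ.indicator hA)]
      refine lintegral_congr_ae (hac.mono fun s hs => ?_)
      have hAs : MeasurableSet (Prod.mk s ⁻¹' A) := measurable_prodMk_left hA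
      dsimp only
      rw [← Measure.setLIntegral_rnDeriv hs, ← lintegral_indicator hAs]
      rfl
    have hrnDeriv : (ρ ⊗ₘ κ).rnDeriv (ρ ⊗ₘ η) =ᵐ[ρ ⊗ₘ η] φ :=
      hdensity ▸ Measure.rnDeriv_withDensity _ hφ
    rw [klDiv_eq_lintegral_klFun_of_ac (Measure.AbsolutelyContinuous.compProd_right hac),
      lintegral_congr_ae (g := fun x => ENNReal.ofReal (klFun (φ x).toReal))
        (hrnDeriv.mono fun x hx => by rw [hx]),
      Measure.lintegral_compProd (by fun_prop), lintegral_fintype]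
    refine Finset.sum_congr rfl fun s _ => ?_
    by_cases hs : ρ {s} = 0
    · simp [hs]
    · rw [klDiv_eq_lintegral_klFun_of_ac (ae_iff_of_countable.1 hac s hs), mul_comm]
  · rw [klDiv_of_not_ac (mt Measure.absolutelyContinuous_compProd_right_iff.1 hac), eq_comm,
      ENNReal.sum_eq_top]
    simp only [ae_iff_of_countable, not_forall] at hac
    obtain ⟨s, hs, hs'⟩ := hac
    exact ⟨s, Finset.mem_univ s, by rw [klDiv_of_not_ac hs', ENNReal.mul_top hs]⟩

variable [StandardBorelSpace α] [Nonempty α] [StandardBorelSpace β] [Nonempty β]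
  {κ : Kernel S Ω} [IsMarkovKernel κ] {U : Ω → α} {V : Ω → β} {Z : Ω → γ}

section

variable [Countable S]

/-- The conditional law of `U` given a discrete state `s` and `Z`, when the underlying point
is drawn from `κ s`. It is glued from the conditional laws for the individual states. -/
noncomputable def statewiseCondDistrib (U : Ω → α) (Z : Ω → γ) (κ : Kernel S Ω)
    [IsMarkovKernel κ] : Kernel (S × γ) α where
  toFun v := condDistrib U Z (κ v.1) v.2
  measurable' := measurable_from_prod_countable_right fun s => (condDistrib U Z (κ s)).measurable

instance : IsMarkovKernel (statewiseCondDistrib U Z κ) :=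
  ⟨fun v => inferInstanceAs (IsProbabilityMeasure (condDistrib U Z (κ v.1) v.2))⟩

theorem sectR_statewiseCondDistrib (s : S) :
    (statewiseCondDistrib U Z κ).sectR s = condDistrib U Z (κ s) :=
  rfl

theorem map_compProd_statewiseCondDistrib (hU : Measurable U) (hZ : Measurable Z) :
    κ.map Z ⊗ₖ statewiseCondDistrib U Z κ = κ.map fun ω => (Z ω, U ω) := by
  have := Kernel.IsMarkovKernel.map κ hZ
  ext s : 1
  rw [Kernel.compProd_apply_eq_compProd_sectR, sectR_statewiseCondDistrib, Kernel.map_apply κ hZ,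
    compProd_map_condDistrib hU.aemeasurable, Kernel.map_apply κ (hZ.prodMk hU)]

theorem condDistrib_snd_ae_eq_statewiseCondDistrib (ρ : Measure S) [IsFiniteMeasure ρ]
    (hU : Measurable U) (hZ : Measurable Z) :
    condDistrib (fun ω => U ω.2) (fun ω => (ω.1, Z ω.2)) (ρ ⊗ₘ κ)
      =ᵐ[(ρ ⊗ₘ κ).map fun ω => (ω.1, Z ω.2)] statewiseCondDistrib U Z κ := by
  refine condDistrib_ae_eq_of_measure_eq_compProd _ (by fun_prop) ?_
  rw [map_prodMk_fst_compProd ρ hZ, map_compProd_statewiseCondDistrib hU hZ,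
    Measure.compProd_map (by fun_prop), Measure.map_map (by fun_prop) (by fun_prop)]
  rfl

end

theorem condMutualInfo_compProd_eq_sum [Fintype S] (ρ : Measure S) [IsFiniteMeasure ρ]
    (hU : Measurable U) (hV : Measurable V) (hZ : Measurable Z) :
    condMutualInfo (fun ω => U ω.2) (fun ω => V ω.2) (fun ω => (ω.1, Z ω.2)) (ρ ⊗ₘ κ) =
      ∑ s, ρ {s} * condMutualInfo U V Z (κ s) := by
  have := Kernel.IsMarkovKernel.map κ hZ
  have := Kernel.IsMarkovKernel.map κ (hZ.prodMk (hU.prodMk hV))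
  have hjoint : (ρ ⊗ₘ κ).map (fun ω => ((ω.1, Z ω.2), (U ω.2, V ω.2))) =
      (ρ ⊗ₘ κ.map fun ω => (Z ω, (U ω, V ω))).map MeasurableEquiv.prodAssoc.symm := by
    rw [Measure.compProd_map (by fun_prop), Measure.map_map (by fun_prop) (by fun_prop)]
    rfl
  rw [condMutualInfo_eq_klDiv_of_ae_eq (condDistrib_snd_ae_eq_statewiseCondDistrib ρ hU hZ)
      (condDistrib_snd_ae_eq_statewiseCondDistrib ρ hV hZ), hjoint, map_prodMk_fst_compProd ρ hZ,
    klDiv_map_eq_of_leftInverse _ _ MeasurableEquiv.prodAssoc.symm.measurable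
      MeasurableEquiv.prodAssoc.measurable MeasurableEquiv.prodAssoc.right_inv,
    klDiv_compProd_right_eq_sum]
  refine Finset.sum_congr rfl fun s _ => ?_
  rw [Kernel.map_apply κ (hZ.prodMk (hU.prodMk hV)), Kernel.compProd_apply_eq_compProd_sectR,
    Kernel.map_apply κ hZ, condMutualInfo, sectR_prod, sectR_statewiseCondDistrib,
    sectR_statewiseCondDistrib]

end Mixture

section Exchange

variable {Ω α β γ δ : Type*} [MeasurableSpace Ω]
  [MeasurableSpace α] [StandardBorelSpace α] [Nonempty α]
  [MeasurableSpace β] [StandardBorelSpace β] [Nonempty β]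
  [MeasurableSpace δ] [StandardBorelSpace δ] [Nonempty δ]
  [MeasurableSpace γ] {μ : Measure Ω} [IsFiniteMeasure μ]
  {U : Ω → α} {V : Ω → β} {W : Ω → δ} {Z : Ω → γ}

theorem condMutualInfo_prodMk_left (hU : Measurable U) (hV : Measurable V) (hW : Measurable W)
    (hZ : Measurable Z) :
    condMutualInfo (fun ω => (U ω, W ω)) V Z μ =
      condMutualInfo U V Z μ + condMutualInfo W V (fun ω => (Z ω, U ω)) μ := by
  rw [condMutualInfo_comm (hU.prodMk hW) hV hZ, condMutualInfo_prodMk_right hV hU hW hZ,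
    condMutualInfo_comm hV hU hZ, condMutualInfo_comm hV hW (hZ.prodMk hU)]

variable [StandardBorelSpace γ] [Nonempty γ]

theorem condMutualInfo_le_of_condMutualInfo_eq_zero (hU : Measurable U) (hV : Measurable V)
    (hW : Measurable W) (hZ : Measurable Z) (h : condMutualInfo U W Z μ = 0) :
    condMutualInfo U V Z μ ≤ condMutualInfo U V (fun ω => (Z ω, W ω)) μ :=
  calc condMutualInfo U V Z μ
      ≤ condMutualInfo U (fun ω => (V ω, W ω)) Z μ :=
        condMutualInfo_prodMk_right (μ := μ) hU hV hW hZ ▸ le_self_add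
    _ = condMutualInfo U (fun ω => (W ω, V ω)) Z μ :=
        condMutualInfo_congr hU (hW.prodMk hV) hZ hU (hV.prodMk hW) hZ rfl
          (by simp only [Prod.instMeasurableSpace, MeasurableSpace.comap_prodMk, sup_comm]) rfl
    _ = condMutualInfo U V (fun ω => (Z ω, W ω)) μ := by
        rw [condMutualInfo_prodMk_right hU hW hV hZ, h, zero_add]

theorem condMutualInfo_prodMk_le_of_condMutualInfo_eq_zero (hU : Measurable U)
    (hV : Measurable V) (hW : Measurable W) (hZ : Measurable Z)
    (h : condMutualInfo V W (fun ω => (Z ω, U ω)) μ = 0) :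
    condMutualInfo U V (fun ω => (Z ω, W ω)) μ ≤ condMutualInfo U V Z μ :=
  calc condMutualInfo U V (fun ω => (Z ω, W ω)) μ
      ≤ condMutualInfo V (fun ω => (W ω, U ω)) Z μ := by
        rw [condMutualInfo_comm hU hV (hZ.prodMk hW), condMutualInfo_prodMk_right hV hW hU hZ]
        exact le_add_self
    _ = condMutualInfo V (fun ω => (U ω, W ω)) Z μ :=
        condMutualInfo_congr hV (hU.prodMk hW) hZ hV (hW.prodMk hU) hZ rfl
          (by simp only [Prod.instMeasurableSpace, MeasurableSpace.comap_prodMk, sup_comm]) rfl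
    _ = condMutualInfo U V Z μ := by
        rw [condMutualInfo_prodMk_right hV hU hW hZ, h, add_zero, condMutualInfo_comm hV hU hZ]

variable {η ξ ζ : Type*} [MeasurableSpace η] [StandardBorelSpace η] [Nonempty η]
  [MeasurableSpace ξ] [StandardBorelSpace ξ] [Nonempty ξ]
  [MeasurableSpace ζ] [StandardBorelSpace ζ] [Nonempty ζ]
  {K : Ω → δ} {L : Ω → η} {Y : Ω → β} {YK : Ω → ξ} {YL : Ω → ζ}

theorem condMutualInfo_prodMk_add_le (hZ : Measurable Z) (hK : Measurable K) (hL : Measurable L)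
    (hU : Measurable U) (hY : Measurable Y) (hYK : Measurable YK) (hYL : Measurable YL)
    (hKL : condMutualInfo K L Z μ = 0)
    (hYKYL : condMutualInfo YK YL (fun ω => ((((Z ω, K ω), Y ω), L ω), U ω)) μ = 0) :
    condMutualInfo U (fun ω => ((Y ω, YL ω), YK ω)) (fun ω => ((Z ω, L ω), K ω)) μ +
        condMutualInfo (fun ω => (K ω, (L ω, U ω))) Y Z μ ≤
      condMutualInfo (fun ω => (L ω, U ω)) (fun ω => (Y ω, YK ω)) (fun ω => (Z ω, K ω)) μ +
        condMutualInfo (fun ω => (K ω, U ω)) (fun ω => (Y ω, YL ω)) (fun ω => (Z ω, L ω)) μ := by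
  have hLU : condMutualInfo U YK (fun ω => (((Z ω, L ω), K ω), (Y ω, YL ω))) μ ≤
      condMutualInfo (fun ω => (L ω, U ω)) YK (fun ω => ((Z ω, K ω), Y ω)) μ := by
    calc condMutualInfo U YK (fun ω => (((Z ω, L ω), K ω), (Y ω, YL ω))) μ
        = condMutualInfo U YK (fun ω => ((((Z ω, K ω), Y ω), L ω), YL ω)) μ :=
          condMutualInfo_congr hU hYK (by fun_prop) hU hYK (by fun_prop) rfl rfl
            (by simp only [Prod.instMeasurableSpace, MeasurableSpace.comap_prodMk]; ac_rfl)
      _ ≤ condMutualInfo U YK (fun ω => (((Z ω, K ω), Y ω), L ω)) μ :=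
          condMutualInfo_prodMk_le_of_condMutualInfo_eq_zero hU hYK hYL (by fun_prop) hYKYL
      _ ≤ condMutualInfo (fun ω => (L ω, U ω)) YK (fun ω => ((Z ω, K ω), Y ω)) μ := by
          rw [condMutualInfo_prodMk_left hL hYK hU (by fun_prop)]
          exact le_add_self
  have hKY : condMutualInfo K Y Z μ ≤
      condMutualInfo K (fun ω => (Y ω, YL ω)) (fun ω => (Z ω, L ω)) μ :=
    (condMutualInfo_le_of_condMutualInfo_eq_zero hK hY hL hZ hKL).trans
      (condMutualInfo_prodMk_right (μ := μ) hK hY hYL (hZ.prodMk hL) ▸ le_self_add)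
  rw [condMutualInfo_prodMk_right hU (hY.prodMk hYL) hYK (by fun_prop),
    condMutualInfo_prodMk_left hK hY (hL.prodMk hU) hZ,
    condMutualInfo_prodMk_right (hL.prodMk hU) hY hYK (by fun_prop),
    condMutualInfo_prodMk_left hK (hY.prodMk hYL) hU (by fun_prop)]
  exact (add_le_add (add_le_add_right hLU _) (add_le_add_left hKY _)).trans_eq (by ring)

end Exchange

section IndependentCoordinates

variable {E Ω α β : Type*} [MeasurableSpace E] [MeasurableSpace Ω]
  [MeasurableSpace α] [StandardBorelSpace α] [Nonempty α]
  [MeasurableSpace β] [StandardBorelSpace β] [Nonempty β]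

theorem condMutualInfo_compProd_eq_zero {ρ : Measure E} [IsFiniteMeasure ρ] {κ : Kernel E Ω}
    [IsMarkovKernel κ] {U : Ω → α} {V : Ω → β} (hU : Measurable U) (hV : Measurable V)
    (hκ : ∀ e, IndepFun U V (κ e)) :
    condMutualInfo (fun ω => U ω.2) (fun ω => V ω.2) Prod.fst (ρ ⊗ₘ κ) = 0 := by
  have := Kernel.IsMarkovKernel.map κ hU
  have := Kernel.IsMarkovKernel.map κ hV
  have hprod : κ.map U ×ₖ κ.map V = κ.map fun ω => (U ω, V ω) := by
    ext e : 1
    rw [Kernel.prod_apply, Kernel.map_apply κ hU, Kernel.map_apply κ hV,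
      Kernel.map_apply κ (hU.prodMk hV),
      (indepFun_iff_map_prod_eq_prod_map_map hU.aemeasurable hV.aemeasurable).1 (hκ e)]
  refine condMutualInfo_eq_zero_of_map_eq_compProd_prod (by fun_prop) (by fun_prop)
    measurable_fst (κ := κ.map U) (η := κ.map V) ?_
  rw [hprod, ← Measure.fst, Measure.fst_compProd, Measure.compProd_map (hU.prodMk hV)]
  rfl

variable {ι : Type*} {A : ι → Type*} [mA : ∀ i, MeasurableSpace (A i)]

theorem comap_restrict {Ω : Type*} (f : Ω → ∀ i, A i) (I : Finset ι) :
    MeasurableSpace.pi.comap (fun ω => I.restrict (f ω)) =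
      ⨆ i ∈ I, (mA i).comap fun ω => f ω i := by
  rw [MeasurableSpace.comap_process_pi, iSup_subtype]
  rfl

variable [∀ i, StandardBorelSpace (A i)] [∀ i, Nonempty (A i)] {I J K : Finset ι}

theorem condMutualInfo_compProd_restrict_eq_zero {ρ : Measure E} [IsFiniteMeasure ρ]
    {κ : Kernel E (∀ i, A i)} [IsMarkovKernel κ] (hκ : ∀ e, iIndepFun (fun i x => x i) (κ e))
    (hIJ : Disjoint I J) (hJK : Disjoint J K) :
    condMutualInfo (fun ω => J.restrict ω.2) (fun ω => K.restrict ω.2)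
      (fun ω => (ω.1, I.restrict ω.2)) (ρ ⊗ₘ κ) = 0 := by
  classical
  have hindep (e : E) : IndepFun (fun x : ∀ i, A i => J.restrict x)
      (fun x => (I.restrict x, K.restrict x)) (κ e) :=
    ((hκ e).indepFun_finset J (I ∪ K) (Finset.disjoint_union_right.2 ⟨hIJ.symm, hJK⟩)
      fun i => measurable_pi_apply i).comp (φ := id)
      (ψ := fun x => (Finset.restrict₂ Finset.subset_union_left x,
        Finset.restrict₂ Finset.subset_union_right x)) measurable_id
      ((Finset.measurable_restrict₂ _).prodMk (Finset.measurable_restrict₂ _))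
  have hzero := condMutualInfo_compProd_eq_zero (ρ := ρ) (by fun_prop) (by fun_prop) hindep
  rw [condMutualInfo_prodMk_right (by fun_prop) (by fun_prop) (by fun_prop) (by fun_prop)]
    at hzero
  exact (add_eq_zero.1 hzero).2

theorem condMutualInfo_restrict_eq_zero {μ : Measure (∀ i, A i)} [IsProbabilityMeasure μ]
    (hμ : iIndepFun (fun i x => x i) μ) (hIJ : Disjoint I J) (hJK : Disjoint J K) :
    condMutualInfo (fun x => J.restrict x) (fun x => K.restrict x) (fun x => I.restrict x) μ
      = 0 := by
  have hsnd : (Measure.dirac () ⊗ₘ Kernel.const Unit μ).map Prod.snd = μ := by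
    rw [Measure.compProd_const, ← Measure.snd, Measure.snd_prod]
  have hlift := condMutualInfo_map (ν := Measure.dirac () ⊗ₘ Kernel.const Unit μ) measurable_snd
    (Finset.measurable_restrict J) (Finset.measurable_restrict K) (Finset.measurable_restrict I)
  simp only [hsnd] at hlift
  rw [hlift, ← condMutualInfo_compProd_restrict_eq_zero (ρ := Measure.dirac ())
    (κ := Kernel.const Unit μ) (fun _ => hμ) hIJ hJK]
  refine condMutualInfo_congr (by fun_prop) (by fun_prop) (by fun_prop) (by fun_prop)
    (by fun_prop) (by fun_prop) rfl rfl ?_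
  rw [Prod.instMeasurableSpace, MeasurableSpace.comap_prodMk]
  have hunit : MeasurableSpace.comap (Prod.fst : Unit × (∀ i, A i) → Unit) inferInstance = ⊥ :=
    MeasurableSpace.comap_const ()
  rw [hunit, bot_sup_eq]
  rfl

end IndependentCoordinates

/-! ### Channels with independent inputs and independent noises -/

section BlockMutualInfo

variable {ι ι' : Type*} {X : ι → Type*} {Y : ι' → Type*}
  [∀ i, MeasurableSpace (X i)] [∀ i, StandardBorelSpace (X i)] [∀ i, Nonempty (X i)]
  [∀ j, MeasurableSpace (Y j)]
  {μ : Measure (∀ i, X i)} [IsProbabilityMeasure μ]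
  {κ : Kernel (∀ i, X i) (∀ j, Y j)} [IsMarkovKernel κ]

theorem condMutualInfo_restrict_input_eq_zero (hμ : iIndepFun (fun i x => x i) μ)
    {I J K : Finset ι} (hIJ : Disjoint I J) (hJK : Disjoint J K) :
    condMutualInfo (fun ω => J.restrict ω.1) (fun ω => K.restrict ω.1)
      (fun ω => I.restrict ω.1) (μ ⊗ₘ κ) = 0 := by
  have hfst := condMutualInfo_map (ν := μ ⊗ₘ κ) measurable_fst
    (Finset.measurable_restrict J) (Finset.measurable_restrict K) (Finset.measurable_restrict I)
  have hfst_eq : (μ ⊗ₘ κ).map Prod.fst = μ := Measure.fst_compProd μ κ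
  simp only [hfst_eq] at hfst
  exact hfst.symm.trans (condMutualInfo_restrict_eq_zero hμ hIJ hJK)

variable [Fintype ι] [DecidableEq ι] [∀ j, StandardBorelSpace (Y j)] [∀ j, Nonempty (Y j)]

theorem condMutualInfo_restrict_output_eq_zero (hκ : ∀ x, iIndepFun (fun j y => y j) (κ x))
    {I J K L : Finset ι} (hcover : I ∪ J ∪ K ∪ L = Finset.univ) {I' J' K' : Finset ι'}
    (hIJ : Disjoint I' J') (hJK : Disjoint J' K') :
    condMutualInfo (fun ω => J'.restrict ω.2) (fun ω => K'.restrict ω.2)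
      (fun ω => ((((I.restrict ω.1, J.restrict ω.1), I'.restrict ω.2), K.restrict ω.1),
        L.restrict ω.1)) (μ ⊗ₘ κ) = 0 := by
  rw [← condMutualInfo_compProd_restrict_eq_zero (ρ := μ) hκ hIJ hJK]
  refine condMutualInfo_congr (by fun_prop) (by fun_prop) (by fun_prop) (by fun_prop)
    (by fun_prop) (by fun_prop) rfl rfl ?_
  simp only [Prod.instMeasurableSpace, MeasurableSpace.comap_prodMk, comap_restrict]
  rw [MeasurableSpace.comap_process_pi]
  conv_rhs => enter [1]; rw [← iSup_univ, ← Finset.coe_univ, ← hcover]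
  simp only [Finset.mem_coe, Finset.iSup_union]
  ac_rfl

/-- `I(X_{Iᶜ}; Y_J | X_I)` for a joint law `ν` of input and output vectors: the information that
flows from the inputs outside `I` to the outputs in `J`. -/
noncomputable def blockMutualInfo (ν : Measure ((∀ i, X i) × ∀ j, Y j)) [IsFiniteMeasure ν]
    (I : Finset ι) (J : Finset ι') : ℝ≥0∞ :=
  condMutualInfo (fun ω => (Iᶜ).restrict ω.1) (fun ω => J.restrict ω.2)
    (fun ω => I.restrict ω.1) ν

theorem blockMutualInfo_union_add_inter_le [DecidableEq ι']
    (hμ : iIndepFun (fun i x => x i) μ) (hκ : ∀ x, iIndepFun (fun j y => y j) (κ x))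
    (I₁ I₂ : Finset ι) (J₁ J₂ : Finset ι') :
    blockMutualInfo (μ ⊗ₘ κ) (I₁ ∪ I₂) (J₁ ∪ J₂) + blockMutualInfo (μ ⊗ₘ κ) (I₁ ∩ I₂) (J₁ ∩ J₂) ≤
      blockMutualInfo (μ ⊗ₘ κ) I₁ J₁ + blockMutualInfo (μ ⊗ₘ κ) I₂ J₂ := by
  let x (I : Finset ι) (ω : (∀ i, X i) × ∀ j, Y j) : ∀ i : I, X i := I.restrict ω.1
  let y (J : Finset ι') (ω : (∀ i, X i) × ∀ j, Y j) : ∀ j : J, Y j := J.restrict ω.2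
  have hx (I : Finset ι) : Measurable (x I) := by fun_prop
  have hy (J : Finset ι') : Measurable (y J) := by fun_prop
  have hinputs : condMutualInfo (x (I₁ \ I₂)) (x (I₂ \ I₁)) (x (I₁ ∩ I₂)) (μ ⊗ₘ κ) = 0 :=
    condMutualInfo_restrict_input_eq_zero hμ (Finset.disjoint_sdiff_inter I₁ I₂).symm
      disjoint_sdiff_sdiff
  have houtputs : condMutualInfo (y (J₁ \ J₂)) (y (J₂ \ J₁)) (fun ω => ((((x (I₁ ∩ I₂) ω,
      x (I₁ \ I₂) ω), y (J₁ ∩ J₂) ω), x (I₂ \ I₁) ω), x (I₁ ∪ I₂)ᶜ ω)) (μ ⊗ₘ κ) = 0 :=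
    condMutualInfo_restrict_output_eq_zero hκ (by grind [Finset.mem_compl])
      (Finset.disjoint_sdiff_inter J₁ J₂).symm disjoint_sdiff_sdiff
  have hexchange := condMutualInfo_prodMk_add_le (hx (I₁ ∩ I₂)) (hx (I₁ \ I₂)) (hx (I₂ \ I₁))
    (hx (I₁ ∪ I₂)ᶜ) (hy (J₁ ∩ J₂)) (hy (J₁ \ J₂)) (hy (J₂ \ J₁)) hinputs houtputs
  -- Each block generates the same σ-algebra as the tuple of its parts.
  convert hexchange using 2 <;>
    refine condMutualInfo_congr (by fun_prop) (by fun_prop) (by fun_prop) (by fun_prop)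
      (by fun_prop) (by fun_prop) ?_ ?_ ?_ <;>
    simp only [x, y, Prod.instMeasurableSpace, MeasurableSpace.comap_prodMk, comap_restrict,
      ← Finset.iSup_union] <;>
    refine iSup_congr fun i => iSup_congr_Prop ?_ fun _ => rfl <;>
    grind [Finset.mem_compl]

end BlockMutualInfo

section StateDependentChannel

variable {S ι ι' : Type*} [MeasurableSpace S] [Fintype ι] [DecidableEq ι]
  {X : ι → Type*} {Y : ι' → Type*}
  [∀ i, MeasurableSpace (X i)] [∀ i, StandardBorelSpace (X i)] [∀ i, Nonempty (X i)]
  [∀ j, MeasurableSpace (Y j)] [∀ j, StandardBorelSpace (Y j)] [∀ j, Nonempty (Y j)]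

/-- `I(X_{Iᶜ}; Y_J | X_I, S)` when the state `S` has law `ρ`, the input vector `X` has conditional
law `Q` given the state, and the output vector `Y` is drawn from the channel `W` at `(S, X)`. -/
noncomputable def channelMutualInfo (W : Kernel (S × ∀ i, X i) (∀ j, Y j)) [IsMarkovKernel W]
    (Q : Kernel S (∀ i, X i)) [IsMarkovKernel Q] (ρ : Measure S) [IsProbabilityMeasure ρ]
    (I : Finset ι) (J : Finset ι') : ℝ≥0∞ :=
  condMutualInfo (fun ω : (S × ∀ i, X i) × ∀ j, Y j => (Iᶜ).restrict ω.1.2)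
    (fun ω => J.restrict ω.2) (fun ω => (I.restrict ω.1.2, ω.1.1)) ((ρ ⊗ₘ Q) ⊗ₘ W)

variable [StandardBorelSpace S] [Nonempty S]
  (W : Kernel (S × ∀ i, X i) (∀ j, Y j)) [IsMarkovKernel W]
  (Q : Kernel S (∀ i, X i)) [IsMarkovKernel Q] (ρ : Measure S) [IsProbabilityMeasure ρ]
  (I : Finset ι) (J : Finset ι')

theorem channelMutualInfo_eq_sum [Fintype S] :
    channelMutualInfo W Q ρ I J =
      ∑ s, ρ {s} * blockMutualInfo (Q s ⊗ₘ W.sectR s) I J := by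
  have hassoc : (ρ ⊗ₘ (Q ⊗ₖ W)).map MeasurableEquiv.prodAssoc.symm = (ρ ⊗ₘ Q) ⊗ₘ W :=
    Measure.compProd_assoc
  have hmap := condMutualInfo_map (ν := ρ ⊗ₘ (Q ⊗ₖ W)) MeasurableEquiv.prodAssoc.symm.measurable
    (U := fun ω : (S × ∀ i, X i) × ∀ j, Y j => (Iᶜ).restrict ω.1.2)
    (V := fun ω => J.restrict ω.2) (Z := fun ω => (I.restrict ω.1.2, ω.1.1))
    (by fun_prop) (by fun_prop) (by fun_prop)
  have hsum := condMutualInfo_compProd_eq_sum (κ := Q ⊗ₖ W) ρ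
    (U := fun ω : (∀ i, X i) × ∀ j, Y j => (Iᶜ).restrict ω.1)
    (V := fun ω => J.restrict ω.2) (Z := fun ω => I.restrict ω.1)
    (by fun_prop) (by fun_prop) (by fun_prop)
  simp only [hassoc] at hmap
  simp only [Kernel.compProd_apply_eq_compProd_sectR] at hsum
  rw [channelMutualInfo, hmap]
  refine (condMutualInfo_congr (by fun_prop) (by fun_prop) (by fun_prop) (by fun_prop)
    (by fun_prop) (by fun_prop) rfl rfl ?_).trans hsum
  change MeasurableSpace.comap (fun ω : S × (∀ i, X i) × ∀ j, Y j => (I.restrict ω.2.1, ω.1)) _ =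
    MeasurableSpace.comap (fun ω => (ω.1, I.restrict ω.2.1)) _
  simp only [Prod.instMeasurableSpace, MeasurableSpace.comap_prodMk, sup_comm]

end StateDependentChannel

/-! ### Matrix games -/

section MatrixGame

open Filter
open scoped Matrix Topology

variable {ι κ : Type*} [Fintype ι] {M : Matrix ι κ ℝ} {p d : ι → ℝ} {c : ℝ}

theorem eventually_add_smul_mem_stdSimplex (hp : p ∈ stdSimplex ℝ ι)
    (hsupp : d.support ⊆ p.support) (hsum : ∑ s, d s = 0) :
    ∀ᶠ t in 𝓝 (0 : ℝ), p + t • d ∈ stdSimplex ℝ ι := by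
  have hrow (s : ι) : ∀ᶠ t in 𝓝 (0 : ℝ), 0 ≤ p s + t * d s := by
    by_cases hs : p s = 0
    · have hds : d s = 0 := by_contra fun h => hsupp h hs
      exact .of_forall fun t => by rw [hs, hds, mul_zero, add_zero]
    · refine (ContinuousAt.eventually_lt ?_ ?_ ?_).mono fun t ht => ht.le
      · fun_prop
      · fun_prop
      · simpa only [zero_mul, add_zero] using (hp.1 s).lt_of_ne' hs
  filter_upwards [eventually_all.2 hrow] with t ht
  refine ⟨ht, ?_⟩
  simp only [Pi.add_apply, Pi.smul_apply, smul_eq_mul, Finset.sum_add_distrib, ← Finset.mul_sum,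
    hsum, hp.2, mul_zero, add_zero]

theorem vecMul_add_smul_apply (M : Matrix ι κ ℝ) (p d : ι → ℝ) (t : ℝ) (a : κ) :
    ((p + t • d) ᵥ* M) a = (p ᵥ* M) a + t * (d ᵥ* M) a := by
  simp only [Matrix.add_vecMul, Matrix.smul_vecMul, Pi.add_apply, Pi.smul_apply, smul_eq_mul]

theorem exists_direction_of_ncard_lt [Finite κ] (M : Matrix ι κ ℝ) {U : Set ι} {T : Set κ}
    (hTU : T.ncard < U.ncard) :
    ∃ (d : ι → ℝ) (c : ℝ), (d ≠ 0 ∨ c ≠ 0) ∧ d.support ⊆ U ∧ ∑ s, d s = 0 ∧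
      ∀ a ∈ T, (d ᵥ* M) a = c := by
  classical
  have := Fintype.ofFinite κ
  let L : (ι → ℝ) × ℝ →ₗ[ℝ] ((T → ℝ) × ℝ) × ((Uᶜ : Set ι) → ℝ) :=
    { toFun := fun x => ((fun a => (x.1 ᵥ* M) a - x.2, ∑ s, x.1 s), fun s => x.1 s)
      map_add' := fun x y => by
        ext <;> simp [Matrix.add_vecMul, Finset.sum_add_distrib]; ring
      map_smul' := fun r x => by
        ext <;> simp [Matrix.smul_vecMul, Finset.mul_sum, mul_sub] }
  have hker : LinearMap.ker L ≠ ⊥ := by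
    apply LinearMap.ker_ne_bot_of_finrank_lt
    have hU := Set.ncard_add_ncard_compl U
    simp only [Module.finrank_prod, Module.finrank_fintype_fun_eq_card, Module.finrank_self,
      ← Nat.card_eq_fintype_card, Nat.card_coe_set_eq] at hU ⊢
    omega
  obtain ⟨⟨d, c⟩, hL, hne⟩ := (Submodule.ne_bot_iff _).1 hker
  simp only [LinearMap.mem_ker, L, LinearMap.coe_mk, AddHom.coe_mk, Prod.mk_eq_zero] at hL
  refine ⟨d, c, ?_, fun s hs => by_contra fun hsU => hs (congrFun hL.2 ⟨s, hsU⟩), hL.1.2,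
    fun a ha => sub_eq_zero.1 (congrFun hL.1.1 ⟨a, ha⟩)⟩
  rwa [ne_eq, Prod.mk_eq_zero, not_and_or] at hne

variable [Fintype κ] [Nonempty κ]

/-- The payoff of the mixed row strategy `p` in the matrix game `M` against the worst column. -/
noncomputable def worstPayoff (M : Matrix ι κ ℝ) (p : ι → ℝ) : ℝ :=
  Finset.univ.inf' Finset.univ_nonempty (p ᵥ* M)

/-- The mixed row strategies of the matrix game `M` with the greatest worst-case payoff. -/
def optimalStrategies (M : Matrix ι κ ℝ) : Set (ι → ℝ) :=
  {p ∈ stdSimplex ℝ ι | ∀ q ∈ stdSimplex ℝ ι, worstPayoff M q ≤ worstPayoff M p}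

/-- The columns of the matrix game `M` that are worst against the row strategy `p`. -/
def worstColumns (M : Matrix ι κ ℝ) (p : ι → ℝ) : Set κ :=
  {a | (p ᵥ* M) a = worstPayoff M p}

theorem worstPayoff_le (M : Matrix ι κ ℝ) (p : ι → ℝ) (a : κ) : worstPayoff M p ≤ (p ᵥ* M) a :=
  Finset.inf'_le _ (Finset.mem_univ a)

theorem le_worstPayoff_iff : c ≤ worstPayoff M p ↔ ∀ a, c ≤ (p ᵥ* M) a := by
  simp [worstPayoff]

theorem worstColumns_nonempty (M : Matrix ι κ ℝ) (p : ι → ℝ) : (worstColumns M p).Nonempty :=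
  let ⟨a, _, ha⟩ := Finset.exists_mem_eq_inf' Finset.univ_nonempty (p ᵥ* M)
  ⟨a, ha.symm⟩

theorem continuous_worstPayoff (M : Matrix ι κ ℝ) : Continuous (worstPayoff M) :=
  Continuous.finset_inf'_apply _ fun a _ => by simp only [Matrix.vecMul, dotProduct]; fun_prop

theorem worstPayoff_le_worstPayoff_add {M' : Matrix ι κ ℝ} (hp : p ∈ stdSimplex ℝ ι)
    (hM : ∀ s a, M s a ≤ M' s a + c) : worstPayoff M p ≤ worstPayoff M' p + c := by
  rw [← sub_le_iff_le_add, le_worstPayoff_iff]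
  intro a
  rw [sub_le_iff_le_add]
  calc worstPayoff M p ≤ ∑ s, p s * M s a := worstPayoff_le M p a
    _ ≤ ∑ s, p s * (M' s a + c) :=
      Finset.sum_le_sum fun s _ => mul_le_mul_of_nonneg_left (hM s a) (hp.1 s)
    _ = (p ᵥ* M') a + c := by
      simp only [mul_add, Finset.sum_add_distrib, ← Finset.sum_mul, hp.2, one_mul, Matrix.vecMul,
        dotProduct]

theorem eventually_worstPayoff_add_smul (hd : ∀ a ∈ worstColumns M p, (d ᵥ* M) a = c) :
    ∀ᶠ t in 𝓝 (0 : ℝ), worstPayoff M (p + t • d) = worstPayoff M p + t * c := by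
  have hcolumn (a : κ) : ∀ᶠ t in 𝓝 (0 : ℝ),
      worstPayoff M p + t * c ≤ (p ᵥ* M) a + t * (d ᵥ* M) a := by
    by_cases ha : a ∈ worstColumns M p
    · exact .of_forall fun t => by rw [ha, hd a ha]
    · have hlt : worstPayoff M p < (p ᵥ* M) a :=
        (worstPayoff_le M p a).lt_of_ne fun h => ha h.symm
      refine (ContinuousAt.eventually_lt ?_ ?_ ?_).mono fun t ht => ht.le
      · fun_prop
      · fun_prop
      · simpa only [zero_mul, add_zero] using hlt
  filter_upwards [eventually_all.2 hcolumn] with t ht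
  obtain ⟨a, ha⟩ := worstColumns_nonempty M p
  refine le_antisymm ((worstPayoff_le M _ a).trans_eq ?_) (le_worstPayoff_iff.2 fun b => ?_)
  · rw [vecMul_add_smul_apply, ha, hd a ha]
  · exact (ht b).trans_eq (vecMul_add_smul_apply M p d t b).symm

theorem slope_eq_zero_of_mem_optimalStrategies (hp : p ∈ optimalStrategies M)
    (hsupp : d.support ⊆ p.support) (hsum : ∑ s, d s = 0)
    (hd : ∀ a ∈ worstColumns M p, (d ᵥ* M) a = c) : c = 0 := by
  have hmax : IsLocalMax (fun t => worstPayoff M p + t * c) 0 := by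
    filter_upwards [eventually_add_smul_mem_stdSimplex hp.1 hsupp hsum,
      eventually_worstPayoff_add_smul hd] with t hmem heq
    rw [← heq, zero_mul, add_zero]
    exact hp.2 _ hmem
  refine hmax.hasDerivAt_eq_zero ?_
  simpa using ((hasDerivAt_id (0 : ℝ)).mul_const c).const_add (worstPayoff M p)

theorem direction_eq_zero_of_mem_extremePoints
    (hp : p ∈ (optimalStrategies M).extremePoints ℝ) (hsupp : d.support ⊆ p.support)
    (hsum : ∑ s, d s = 0) (hd : ∀ a ∈ worstColumns M p, (d ᵥ* M) a = c) : d = 0 := by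
  have hc : c = 0 := slope_eq_zero_of_mem_optimalStrategies hp.1 hsupp hsum hd
  have hopt : ∀ᶠ t in 𝓝 (0 : ℝ), p + t • d ∈ optimalStrategies M := by
    filter_upwards [eventually_add_smul_mem_stdSimplex hp.1.1 hsupp hsum,
      eventually_worstPayoff_add_smul hd] with t hmem heq
    refine ⟨hmem, fun q hq => (hp.1.2 q hq).trans ?_⟩
    simp [heq, hc]
  have hopt_neg : ∀ᶠ t in 𝓝 (0 : ℝ), p + -t • d ∈ optimalStrategies M :=
    (continuous_neg.tendsto' 0 0 neg_zero).eventually hopt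
  obtain ⟨t, ⟨hpos, hneg⟩, ht⟩ :=
    (((hopt.and hopt_neg).filter_mono nhdsWithin_le_nhds).and
      (self_mem_nhdsWithin : Set.Ioi (0 : ℝ) ∈ 𝓝[>] 0)).exists
  have hmid : p ∈ openSegment ℝ (p + t • d) (p + -t • d) :=
    ⟨1 / 2, 1 / 2, by norm_num, by norm_num, by norm_num, by module⟩
  have heq : p + t • d = p := hp.2 hpos hneg hmid
  exact (smul_eq_zero.1 (add_eq_left.1 heq)).resolve_left (ne_of_gt ht)

theorem ncard_support_le_ncard_worstColumns (hp : p ∈ (optimalStrategies M).extremePoints ℝ) :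
    p.support.ncard ≤ (worstColumns M p).ncard := by
  by_contra! hlt
  obtain ⟨d, c, hne, hsupp, hsum, hd⟩ := exists_direction_of_ncard_lt M hlt
  exact hne.elim (fun h => h (direction_eq_zero_of_mem_extremePoints hp hsupp hsum hd))
    fun h => h (slope_eq_zero_of_mem_optimalStrategies hp.1 hsupp hsum hd)

theorem isCompact_optimalStrategies (M : Matrix ι κ ℝ) : IsCompact (optimalStrategies M) := by
  have hclosed :
      IsClosed {p : ι → ℝ | ∀ q ∈ stdSimplex ℝ ι, worstPayoff M q ≤ worstPayoff M p} := by
    simp only [Set.ofPred_forall]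
    exact isClosed_biInter fun q _ => isClosed_le continuous_const (continuous_worstPayoff M)
  exact (isCompact_stdSimplex ℝ ι).inter_right hclosed

theorem optimalStrategies_nonempty [Nonempty ι] (M : Matrix ι κ ℝ) :
    (optimalStrategies M).Nonempty := by
  classical
  exact (isCompact_stdSimplex ℝ ι).exists_isMaxOn
    ⟨_, single_mem_stdSimplex ℝ (Classical.arbitrary ι)⟩ (continuous_worstPayoff M).continuousOn

theorem exists_mem_optimalStrategies_ncard_support_le [Nonempty ι] (M : Matrix ι κ ℝ) :
    ∃ p ∈ optimalStrategies M, p.support.ncard ≤ (worstColumns M p).ncard :=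
  let ⟨p, hp⟩ := (isCompact_optimalStrategies M).extremePoints_nonempty
    (optimalStrategies_nonempty M)
  ⟨p, hp.1, ncard_support_le_ncard_worstColumns hp⟩

theorem optimalStrategies_inter_nonempty_of_approx {K : Set (ι → ℝ)} (hK : IsCompact K)
    (hKs : K ⊆ stdSimplex ℝ ι)
    (happrox : ∀ δ > 0, ∃ M' : Matrix ι κ ℝ, (∀ s a, M' s a ≤ M s a) ∧
      (∀ s a, M s a ≤ M' s a + δ) ∧ (optimalStrategies M' ∩ K).Nonempty) :
    (optimalStrategies M ∩ K).Nonempty := by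
  obtain ⟨-, -, -, r₁, -, hr₁⟩ := happrox 1 one_pos
  obtain ⟨p, hpK, hmax⟩ := hK.exists_isMaxOn ⟨r₁, hr₁⟩ (continuous_worstPayoff M).continuousOn
  refine ⟨p, ⟨hKs hpK, fun q hq => le_of_forall_pos_le_add fun δ hδ => ?_⟩, hpK⟩
  obtain ⟨M', hle, hle_add, r, hr, hrK⟩ := happrox δ hδ
  calc worstPayoff M q ≤ worstPayoff M' q + δ := worstPayoff_le_worstPayoff_add hq hle_add
    _ ≤ worstPayoff M' r + δ := by gcongr; exact hr.2 q hq
    _ ≤ worstPayoff M r + δ := by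
      gcongr
      simpa using worstPayoff_le_worstPayoff_add (c := 0) hr.1 (by simpa using hle)
    _ ≤ worstPayoff M p + δ := by gcongr; exact hmax hrK

end MatrixGame

section SubmodularGame

open scoped Matrix

variable {ι α : Type*} [Fintype ι] [DecidableEq α] {M : Matrix ι (Finset α) ℝ}

theorem vecMul_union_add_inter_lt
    (hM : ∀ s A B, ¬ A ⊆ B → ¬ B ⊆ A → M s (A ∪ B) + M s (A ∩ B) < M s A + M s B)
    {p : ι → ℝ} (hp : p ∈ stdSimplex ℝ ι) {A B : Finset α} (hAB : ¬ A ⊆ B) (hBA : ¬ B ⊆ A) :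
    (p ᵥ* M) (A ∪ B) + (p ᵥ* M) (A ∩ B) < (p ᵥ* M) A + (p ᵥ* M) B := by
  simp only [Matrix.vecMul, dotProduct, ← Finset.sum_add_distrib, ← mul_add]
  obtain ⟨s, -, hs⟩ : ∃ s ∈ Finset.univ, 0 < p s :=
    Finset.exists_lt_of_sum_lt (by simp [hp.2])
  exact Finset.sum_lt_sum
    (fun s _ => mul_le_mul_of_nonneg_left (hM s A B hAB hBA).le (hp.1 s))
    ⟨s, Finset.mem_univ s, mul_lt_mul_of_pos_left (hM s A B hAB hBA) hs⟩

theorem sq_card_add_sq_card_lt {A B : Finset α} (hAB : ¬ A ⊆ B) (hBA : ¬ B ⊆ A) :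
    (A.card : ℝ) ^ 2 + (B.card : ℝ) ^ 2 < ((A ∪ B).card : ℝ) ^ 2 + ((A ∩ B).card : ℝ) ^ 2 := by
  have hsum : ((A ∪ B).card : ℝ) + (A ∩ B).card = A.card + B.card := by
    exact_mod_cast Finset.card_union_add_card_inter A B
  have hA : ((A ∩ B).card : ℝ) < A.card := by
    exact_mod_cast Finset.card_lt_card
      ⟨Finset.inter_subset_left, fun h => hAB (Finset.subset_inter_iff.1 h).2⟩
  have hB : ((A ∩ B).card : ℝ) < B.card := by
    exact_mod_cast Finset.card_lt_card
      ⟨Finset.inter_subset_right, fun h => hBA (Finset.subset_inter_iff.1 h).1⟩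
  rw [eq_sub_of_add_eq hsum]
  nlinarith [mul_pos (sub_pos.2 hA) (sub_pos.2 hB)]

variable [Fintype α]

theorem ncard_minimizers_le {F : Finset α → ℝ} {v : ℝ} (hv : ∀ A, v ≤ F A)
    (hF : ∀ A B, ¬ A ⊆ B → ¬ B ⊆ A → F (A ∪ B) + F (A ∩ B) < F A + F B) :
    {A | F A = v}.ncard ≤ Fintype.card α + 1 := by
  have hcard : Set.InjOn Finset.card {A | F A = v} := by
    intro A hA B hB hAB
    by_contra hne
    have hlt := hF A B (fun h => hne (Finset.eq_of_subset_of_card_le h hAB.ge))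
      fun h => hne (Finset.eq_of_subset_of_card_le h hAB.le).symm
    rw [Set.mem_ofPred_eq] at hA hB
    linarith [hv (A ∪ B), hv (A ∩ B)]
  calc {A | F A = v}.ncard ≤ (Set.Iio (Fintype.card α + 1)).ncard :=
        Set.ncard_le_ncard_of_injOn Finset.card (fun A _ => Nat.lt_succ_of_le A.card_le_univ) hcard
    _ = Fintype.card α + 1 := by simp

theorem exists_mem_optimalStrategies_ncard_support_le_card_add_one_of_lt [Nonempty ι]
    (hM : ∀ s A B, ¬ A ⊆ B → ¬ B ⊆ A → M s (A ∪ B) + M s (A ∩ B) < M s A + M s B) :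
    ∃ p ∈ optimalStrategies M, p.support.ncard ≤ Fintype.card α + 1 := by
  obtain ⟨p, hp, hsupp⟩ := exists_mem_optimalStrategies_ncard_support_le M
  exact ⟨p, hp, hsupp.trans <| ncard_minimizers_le (worstPayoff_le M p) fun _ _ =>
    vecMul_union_add_inter_lt hM hp.1⟩

theorem isCompact_stdSimplex_inter_ncard_support_le (n : ℕ) :
    IsCompact (stdSimplex ℝ ι ∩ {p | p.support.ncard ≤ n}) := by
  have hunion : {p : ι → ℝ | p.support.ncard ≤ n} =
      ⋃ U ∈ {U : Set ι | U.ncard ≤ n}, {p | ∀ s ∉ U, p s = 0} := by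
    ext p
    simp only [Set.mem_iUnion, Set.mem_ofPred_eq, exists_prop]
    exact ⟨fun h => ⟨p.support, h, fun s hs => Function.notMem_support.1 hs⟩,
      fun ⟨U, hU, h⟩ => (Set.ncard_le_ncard (Function.support_subset_iff'.2 h)).trans hU⟩
  rw [hunion]
  refine (isCompact_stdSimplex ℝ ι).inter_right (Set.toFinite _ |>.isClosed_biUnion fun U _ => ?_)
  simp only [Set.ofPred_forall]
  exact isClosed_biInter fun s _ => isClosed_eq (continuous_apply s) continuous_const

theorem exists_mem_optimalStrategies_ncard_support_le_card_add_one [Nonempty ι]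
    (hM : ∀ s A B, M s (A ∪ B) + M s (A ∩ B) ≤ M s A + M s B) :
    ∃ p ∈ optimalStrategies M, p.support.ncard ≤ Fintype.card α + 1 := by
  set n := Fintype.card α
  suffices h : (optimalStrategies M ∩ (stdSimplex ℝ ι ∩ {p | p.support.ncard ≤ n + 1})).Nonempty by
    obtain ⟨p, hp, -, hsupp⟩ := h
    exact ⟨p, hp, hsupp⟩
  refine optimalStrategies_inter_nonempty_of_approx
    (isCompact_stdSimplex_inter_ncard_support_le _) Set.inter_subset_left fun δ hδ => ?_
  obtain ⟨ε, hε, hεδ⟩ : ∃ ε > 0, ε * (n : ℝ) ^ 2 ≤ δ :=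
    ⟨δ / ((n : ℝ) ^ 2 + 1), by positivity, by
      rw [div_mul_eq_mul_div, div_le_iff₀ (by positivity)]; nlinarith⟩
  obtain ⟨p, hp, hsupp⟩ := exists_mem_optimalStrategies_ncard_support_le_card_add_one_of_lt
    (M := fun s A => M s A - ε * (A.card : ℝ) ^ 2) fun s A B hAB hBA => by
      linarith [hM s A B, mul_lt_mul_of_pos_left (sq_card_add_sq_card_lt hAB hBA) hε]
  refine ⟨_, fun s A => sub_le_self _ (by positivity), fun s A => ?_, p, hp, hp.1, hsupp⟩
  have hA : ε * (A.card : ℝ) ^ 2 ≤ ε * (n : ℝ) ^ 2 := by gcongr; exact A.card_le_univ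
  linarith

end SubmodularGame

section MixedPMF

open scoped Matrix

variable {S κ α : Type*}

theorem support_toReal_pmf (p : PMF S) : (fun s => (p s).toReal).support = p.support := by
  ext s
  simp [ENNReal.toReal_eq_zero_iff, p.apply_ne_top s]

variable [Fintype S]

theorem toReal_pmf_mem_stdSimplex (q : PMF S) : (fun s => (q s).toReal) ∈ stdSimplex ℝ S := by
  refine ⟨fun s => ENNReal.toReal_nonneg, ?_⟩
  have hsum := q.tsum_coe
  rw [tsum_fintype] at hsum
  rw [← ENNReal.toReal_sum fun s _ => q.apply_ne_top s, hsum, ENNReal.toReal_one]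

theorem exists_pmf_toReal_eq {r : S → ℝ} (hr : r ∈ stdSimplex ℝ S) :
    ∃ p : PMF S, (fun s => (p s).toReal) = r := by
  have hsum : ∑ s, ENNReal.ofReal (r s) = 1 := by
    rw [← ENNReal.ofReal_sum_of_nonneg fun s _ => hr.1 s, hr.2, ENNReal.ofReal_one]
  exact ⟨PMF.ofFintype _ hsum, funext fun s => by simp [ENNReal.toReal_ofReal (hr.1 s)]⟩

theorem iInf_sum_mul_eq_ofReal_worstPayoff [Fintype κ] [Nonempty κ] {F : S → κ → ℝ≥0∞}
    (hF : ∀ s a, F s a ≠ ∞) (q : PMF S) :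
    ⨅ a, ∑ s, q s * F s a =
      ENNReal.ofReal (worstPayoff (fun s a => (F s a).toReal) fun s => (q s).toReal) := by
  have hsum (a : κ) : ∑ s, q s * F s a =
      ENNReal.ofReal (((fun s => (q s).toReal) ᵥ* fun s a => (F s a).toReal) a) := by
    simp only [Matrix.vecMul, dotProduct]
    rw [ENNReal.ofReal_sum_of_nonneg fun s _ => by positivity]
    refine Finset.sum_congr rfl fun s _ => ?_
    rw [← ENNReal.toReal_mul,
      ENNReal.ofReal_toReal (ENNReal.mul_ne_top (q.apply_ne_top s) (hF s a))]
  simp only [hsum]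
  obtain ⟨a, ha⟩ := worstColumns_nonempty (fun s a => (F s a).toReal) fun s => (q s).toReal
  exact le_antisymm (iInf_le_of_le a (ENNReal.ofReal_le_ofReal (le_of_eq ha)))
    (le_iInf fun a => ENNReal.ofReal_le_ofReal (worstPayoff_le _ _ a))

theorem exists_pmf_ncard_support_le_iInf_sum_mul_eq_iSup [Nonempty S] [Fintype α] [DecidableEq α]
    {F : S → Finset α → ℝ≥0∞} (hF : ∀ s A, F s A ≠ ∞)
    (hsub : ∀ s A B, F s (A ∪ B) + F s (A ∩ B) ≤ F s A + F s B) :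
    ∃ p : PMF S, p.support.ncard ≤ Fintype.card α + 1 ∧
      ⨅ A, ∑ s, p s * F s A = ⨆ q : PMF S, ⨅ A, ∑ s, q s * F s A := by
  obtain ⟨r, hr, hsupp⟩ := exists_mem_optimalStrategies_ncard_support_le_card_add_one
    (M := fun s A => (F s A).toReal) fun s A B => by
      rw [← ENNReal.toReal_add (hF _ _) (hF _ _), ← ENNReal.toReal_add (hF _ _) (hF _ _)]
      exact ENNReal.toReal_mono (ENNReal.add_ne_top.2 ⟨hF _ _, hF _ _⟩) (hsub s A B)
  obtain ⟨p, rfl⟩ := exists_pmf_toReal_eq hr.1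
  refine ⟨p, support_toReal_pmf p ▸ hsupp, ?_⟩
  simp only [iInf_sum_mul_eq_ofReal_worstPayoff hF]
  exact le_antisymm (le_iSup_of_le p le_rfl) <| iSup_le fun q =>
    ENNReal.ofReal_le_ofReal (hr.2 _ (toReal_pmf_mem_stdSimplex q))

end MixedPMF

/-! ### Optimal schedules -/

section Schedules

variable {S ι ι' : Type*} [MeasurableSpace S] [StandardBorelSpace S] [Nonempty S]
  [Fintype ι] [DecidableEq ι] {X : ι → Type*} {Y : ι' → Type*}
  [∀ i, MeasurableSpace (X i)] [∀ i, StandardBorelSpace (X i)] [∀ i, Nonempty (X i)]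
  [∀ j, MeasurableSpace (Y j)] [∀ j, StandardBorelSpace (Y j)] [∀ j, Nonempty (Y j)]
  (W : Kernel (S × ∀ i, X i) (∀ j, Y j)) [IsMarkovKernel W]
  (Q : Kernel S (∀ i, X i)) [IsMarkovKernel Q] (I : Finset ι) (J : Finset ι')

theorem channelMutualInfo_toMeasure [Fintype S] (p : PMF S) :
    channelMutualInfo W Q p.toMeasure I J =
      ∑ s, p s * blockMutualInfo (Q s ⊗ₘ W.sectR s) I J := by
  simp only [channelMutualInfo_eq_sum, p.toMeasure_apply_singleton _ (measurableSet_singleton _)]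

theorem channelMutualInfo_toMeasure_pure [Finite S] (s : S) :
    channelMutualInfo W Q (PMF.pure s).toMeasure I J =
      blockMutualInfo (Q s ⊗ₘ W.sectR s) I J := by
  classical
  have := Fintype.ofFinite S
  simp only [channelMutualInfo_toMeasure, PMF.pure_apply, ite_mul, one_mul, zero_mul,
    Finset.sum_ite_eq', Finset.mem_univ, if_true]

end Schedules

theorem iIndepFun_of_eq_pi {ι : Type*} [Fintype ι] {X : ι → Type*}
    [∀ i, MeasurableSpace (X i)] {μ : Measure (∀ i, X i)} [IsProbabilityMeasure μ]
    (hμ : μ = Measure.pi fun i => μ.map fun x => x i) : iIndepFun (fun i (x : ∀ i, X i) => x i) μ :=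
  (iIndepFun_iff_map_fun_eq_pi_map fun i => (measurable_pi_apply i).aemeasurable).2 <|
    (Measure.map_id (μ := μ)).trans hμ

theorem relayNodes_union {N : ℕ} (A B : Finset (Fin N)) :
    relayNodes (A ∪ B) = relayNodes A ∪ relayNodes B :=
  Finset.map_union ..

theorem relayNodes_inter {N : ℕ} (A B : Finset (Fin N)) :
    relayNodes (A ∩ B) = relayNodes A ∩ relayNodes B :=
  Finset.map_inter ..

end HalfDuplex

open MeasureTheory ProbabilityTheory HalfDuplex in
theorem theorem1_general {N : ℕ} {S : Type*} [Finite S] [Nonempty S] [MeasurableSpace S]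
    [DiscreteMeasurableSpace S] {X Y : Fin (N + 1) → Type*}
    [∀ i, MeasurableSpace (X i)] [∀ i, StandardBorelSpace (X i)] [∀ i, Nonempty (X i)]
    [∀ i, MeasurableSpace (Y i)] [∀ i, StandardBorelSpace (Y i)] [∀ i, Nonempty (Y i)]
    (W : Kernel (S × ∀ i, X i) (∀ i, Y i)) [IsMarkovKernel W]
    (hW : ∀ s x, iIndepFun (fun i (y : ∀ i, Y i) => y i) (W (s, x)))
    (Q : Kernel S (∀ i, X i)) [IsMarkovKernel Q]
    (hQ : ∀ s, iIndepFun (fun i (x : ∀ i, X i) => x i) (Q s))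
    (hfin : ∀ (p : PMF S) (A : Finset (Fin N)), channelMutualInfo W Q p.toMeasure
      (relayNodes A) (insert (Fin.last N) (relayNodes A)) ≠ ⊤) :
    ∃ p : PMF S, p.support.ncard ≤ N + 1 ∧
      ⨅ A : Finset (Fin N), channelMutualInfo W Q p.toMeasure
          (relayNodes A) (insert (Fin.last N) (relayNodes A)) =
        ⨆ q : PMF S, ⨅ A : Finset (Fin N), channelMutualInfo W Q q.toMeasure
          (relayNodes A) (insert (Fin.last N) (relayNodes A)) := by
  have := Fintype.ofFinite S
  obtain ⟨p, hcard, hopt⟩ := exists_pmf_ncard_support_le_iInf_sum_mul_eq_iSup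
    (F := fun s A => blockMutualInfo (Q s ⊗ₘ W.sectR s)
      (relayNodes A) (insert (Fin.last N) (relayNodes A)))
    (fun s A => by
      simpa only [channelMutualInfo_toMeasure_pure] using hfin (PMF.pure s) A)
    (fun s A B => by
      simpa only [relayNodes_union, relayNodes_inter, Finset.insert_union_distrib,
        Finset.insert_inter_distrib] using
        blockMutualInfo_union_add_inter_le (κ := W.sectR s) (hQ s) (hW s) _ _ _ _)
  simp only [channelMutualInfo_toMeasure]
  exact ⟨p, hcard.trans_eq (by rw [Fintype.card_fin]), hopt⟩

theorem theorem1 {N : ℕ} {X Y : Fin (N + 1) → Type*}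
    [∀ i, MeasurableSpace (X i)] [∀ i, StandardBorelSpace (X i)] [∀ i, Nonempty (X i)]
    [∀ i, MeasurableSpace (Y i)] [∀ i, StandardBorelSpace (Y i)] [∀ i, Nonempty (Y i)]
    (W : HalfDuplex.Network N X Y) (hW : W.IndependentNoises)
    (Q : ProbabilityTheory.Kernel (HalfDuplex.State N) (∀ i, X i))
    [ProbabilityTheory.IsMarkovKernel Q] (hQ : HalfDuplex.IndependentInputs Q)
    (hfin : ∀ (p : PMF (HalfDuplex.State N)) (A : Finset (Fin N)),
      HalfDuplex.cutInfo W Q p A ≠ ⊤) :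
    ∃ p : PMF (HalfDuplex.State N),
      p.support.ncard ≤ N + 1 ∧
      HalfDuplex.minCutInfo W Q p = HalfDuplex.fixedScheduleRate W Q ∧
      ∀ (B : HalfDuplex.InputConstraint X) (G₁ G₂ : NNReal),
        HalfDuplex.fixedScheduleRate W Q ≤ HalfDuplex.capacity W B + G₁ →
        HalfDuplex.capacity W B ≤ HalfDuplex.fixedScheduleRate W Q + G₂ →
        HalfDuplex.minCutInfo W Q p ≤ HalfDuplex.capacity W B + G₁ ∧
        HalfDuplex.capacity W B ≤ HalfDuplex.minCutInfo W Q p + G₂ := by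
  obtain ⟨p, hcard, hopt : HalfDuplex.minCutInfo W Q p = HalfDuplex.fixedScheduleRate W Q⟩ :=
    theorem1_general W.channel (fun s x => HalfDuplex.iIndepFun_of_eq_pi (hW s x)) Q
      (fun s => HalfDuplex.iIndepFun_of_eq_pi (hQ s)) hfin
  exact ⟨p, hcard, hopt, fun B G₁ G₂ h₁ h₂ => by rw [hopt]; exact ⟨h₁, h₂⟩⟩
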